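/- Let $G$ be a finite connected simple graph with edges $e_1,\dots,e_m$, and let $$P(G)=\Big\{f:E(G)\to\mathbb R_{\ge 0}\ :\ \sum_{e\in E(G)}f(e)=m\Big\}$$ be the simplex of edge weightings of $G$. Its interior consists of the $f\in P(G)$ with $f(e)>0$ for every edge $e$. For edge weights $x=(x_1,\dots,x_m)$ let $$\tau(x)=\sum_{T}\ \prod_{e_j\in T}x_j,\qquad \tau_j(x)=\frac{\partial\tau}{\partial x_j}(x),$$ where $T$ runs over the spanning trees of $G$. The effective resistance of the edge $e_j$ in the weighting $x$ is $\tau_j(x)/\tau(x)$, which is defined when $\tau(x)\neq 0$. (a) If $f$ is in the interior of $P(G)$, then $f$ maximizes $\tau$ on $P(G)$ if and only if all edges have the same effective resistance in the weighting $f$; this is also equivalent to $f$ maximizing $\tau$ on the interior of $P(G)$. (b) If $f\in P(G)$ is any weighting, possibly with some zero weights, such that $\tau(f)\ne 0$ and all edges of $G$ have the same effective resistance in the weighting $f$, then $f$ maximizes $\tau$ on $P(G)$. (c) For the constant weighting $f\equiv 1$, all edges have the same effective resistance if and only if $G$ is equiarboreal, that is, every edge of $G$ lies in the same number of spanning trees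 of $G$. Hence $f\equiv 1$ maximizes $\tau$ on $P(G)$ if and only if $G$ is equiarboreal. -/

import Mathlib

namespace WeightedTrees

variable {V : Type*} [Fintype V] [DecidableEq V] (G : SimpleGraph V) [DecidableRel G.Adj]

/-- The space `P(G)` of edge weightings: nonnegative real functions on the edges of `G` whose
total weight is the number of edges. It is a closed simplex. -/
def weightings : Set (G.edgeSet → ℝ) :=
  {f | (∀ e, 0 ≤ f e) ∧ ∑ e, f e = Fintype.card G.edgeSet}

/-- The interior of `P(G)`: the weightings for which no edge weight vanishes. -/
def positiveWeightings : Set (G.edgeSet → ℝ) :=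
  {f | (∀ e, 0 < f e) ∧ ∑ e, f e = Fintype.card G.edgeSet}

open Classical in
/-- The spanning trees of `G`, as sets of edges: the sets `T` of edges of `G` such that the graph
on all the vertices of `G` with edge set `T` is a tree. -/
noncomputable def spanningTrees : Finset (Finset G.edgeSet) :=
  Finset.univ.filter fun T =>
    (SimpleGraph.fromEdgeSet (Subtype.val '' (T : Set G.edgeSet))).IsTree

/-- The weighted tree number `τ(G)`, as a function of the edge weights. -/
noncomputable def treeNumber (x : G.edgeSet → ℝ) : ℝ :=
  ∑ T ∈ spanningTrees G, ∏ e ∈ T, x e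

/-- The partial derivative `τ_j` of the weighted tree number in the weight of the edge `e`. -/
noncomputable def treeNumberPartial (x : G.edgeSet → ℝ) (e : G.edgeSet) : ℝ :=
  lineDeriv ℝ (treeNumber G) x (Pi.single e 1)

/-- The effective resistance `τ_j / τ` of the edge `e`. -/
noncomputable def effectiveResistance (x : G.edgeSet → ℝ) (e : G.edgeSet) : ℝ :=
  treeNumberPartial G x e / treeNumber G x

/-- A graph is equiarboreal if each of its edges lies in the same number of spanning trees. -/
def Equiarboreal : Prop :=
  ∀ e e' : G.edgeSet,
    ((spanningTrees G).filter fun T => e ∈ T).card =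
      ((spanningTrees G).filter fun T => e' ∈ T).card

end WeightedTrees

/-! With `B` the reduced incidence matrix, the matrix-tree theorem gives τ(x) = det L(x) for L(x) =
B diag(x) Bᵀ, which is linear in x. The effective resistance of e is then the diagonal entry R_e of
Bᵀ L(f)⁻¹ B. Since λ ≤ exp(λ - 1) for every eigenvalue, det C ≤ det A · exp(tr(A⁻¹C) - n), which
becomes τ(g) ≤ τ(f) · exp(Σ g_e R_e - Σ f_e R_e) (`treeNumber_le_mul_exp`). If all R_e agree, the
exponent vanishes because f and g have the same total weight. Only τ(f) ≠ 0 is needed, so zero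
weights are allowed. Conversely, at an interior maximum, moving weight between two edges has zero
first-order effect, so the partial derivatives agree. -/

namespace Matrix

/-! ### Determinants of B diag(x) Bᵀ and a trace bound. -/

variable {n E R : Type*} [Fintype E] [DecidableEq E] [CommRing R]

theorem mul_diagonal_mul_transpose_apply (B : Matrix n E R) (x : E → R) (i j : n) :
    (B * diagonal x * Bᵀ) i j = ∑ e, B i e * x e * B j e := by
  rw [mul_apply]
  simp only [mul_diagonal, transpose_apply]

theorem posSemidef_mul_diagonal_mul_transpose [Finite n] (B : Matrix n E ℝ) {x : E → ℝ}
    (hx : ∀ e, 0 ≤ x e) :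
    (B * diagonal x * Bᵀ).PosSemidef := by
  have := Fintype.ofFinite n
  simpa using (PosSemidef.diagonal (d := x) hx).mul_mul_conjTranspose_same B

variable [Fintype n]

theorem trace_mul_mul_diagonal_mul_transpose (B : Matrix n E R) (A : Matrix n n R) (x : E → R) :
    (A * (B * diagonal x * Bᵀ)).trace = ∑ e, x e * (Bᵀ * A * B) e e := by
  have : (A * (B * diagonal x * Bᵀ)).trace = (Bᵀ * A * B * diagonal x).trace := by
    rw [← Matrix.mul_assoc, trace_mul_comm]
    simp only [Matrix.mul_assoc]
  rw [this]
  simp [trace, mul_diagonal, mul_comm]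

variable [DecidableEq n]

/-- `det (B * diagonal x * Bᵀ)` is a homogeneous multiaffine polynomial in `x`. -/
theorem exists_det_mul_diagonal_mul_transpose_eq_sum (B : Matrix n E R) :
    ∃ c : Finset E → R, ∀ x : E → R, (B * diagonal x * Bᵀ).det =
      ∑ T ∈ Finset.univ.powersetCard (Fintype.card n), c T * ∏ e ∈ T, x e := by
  classical
  refine ⟨fun T => ∑ p : n → E with Function.Injective p ∧ Finset.univ.image p = T,
    (∏ i, B i (p i)) * (of fun i j => B j (p i)).det, fun x => ?_⟩
  have expand : (B * diagonal x * Bᵀ).det =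
      ∑ p : n → E, (∏ i, B i (p i) * x (p i)) * (of fun i j => B j (p i)).det := by
    have rows : B * diagonal x * Bᵀ =
        fun i => ∑ e, (B i e * x e) • (fun j => B j e) := by
      ext i j
      simp [mul_diagonal_mul_transpose_apply]
    rw [rows]
    change (detRowAlternating : (n → R) [⋀^n]→ₗ[R] R).toMultilinearMap
      (fun i => ∑ e, (B i e * x e) • (fun j => B j e)) = _
    rw [MultilinearMap.map_sum]
    refine Finset.sum_congr rfl fun p _ => ?_
    rw [MultilinearMap.map_smul_univ]
    rfl
  -- A repeated edge repeats a row, so only injective choices survive and no variable is squared.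
  have inj : ∀ p : n → E, ¬ Function.Injective p → (of fun i j => B j (p i)).det = 0 := by
    intro p hp
    simp only [Function.Injective, not_forall] at hp
    obtain ⟨i, j, hij, hne⟩ := hp
    exact det_zero_of_row_eq hne (by ext k; simp [hij])
  rw [expand, ← Finset.sum_filter_add_sum_filter_not _ Function.Injective,
    Finset.sum_eq_zero (s := Finset.univ.filter fun p : n → E => ¬ Function.Injective p)
      (fun p hp => by rw [inj p (Finset.mem_filter.1 hp).2, mul_zero]), add_zero,
    ← Finset.sum_fiberwise_of_maps_to (t := Finset.univ.powersetCard (Fintype.card n))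
      (g := fun p => Finset.univ.image p)]
  · refine Finset.sum_congr rfl fun T _ => ?_
    rw [Finset.sum_mul, Finset.filter_filter]
    refine Finset.sum_congr rfl fun p hp => ?_
    obtain ⟨hinj, rfl⟩ := (Finset.mem_filter.1 hp).2
    rw [Finset.prod_image hinj.injOn, Finset.prod_mul_distrib]
    ring
  · intro p hp
    rw [Finset.mem_powersetCard_univ, Finset.card_image_of_injective _ (Finset.mem_filter.1 hp).2,
      Finset.card_univ]

theorem det_mul_diagonal_indicator_mul_transpose (B : Matrix n E R) {T : Finset E} (σ : n ≃ T) :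
    (B * diagonal (fun e => if e ∈ T then (1 : R) else 0) * Bᵀ).det =
      (B.submatrix id fun i => (σ i : E)).det ^ 2 := by
  have : B * diagonal (fun e => if e ∈ T then (1 : R) else 0) * Bᵀ =
      (B.submatrix id fun i => (σ i : E)) * (B.submatrix id fun i => (σ i : E))ᵀ := by
    ext i j
    rw [mul_diagonal_mul_transpose_apply, mul_apply]
    simp only [transpose_apply, submatrix_apply, id, mul_ite, mul_one,
      mul_zero, ite_mul, zero_mul]
    rw [← Finset.sum_filter, Finset.filter_mem_eq_inter, Finset.univ_inter,
      ← Finset.sum_coe_sort, ← σ.sum_comp]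
  rw [this, det_mul, det_transpose, sq]

/-- The **Cauchy–Binet formula** for `B * diagonal x * Bᵀ`. -/
theorem det_mul_diagonal_mul_transpose (B : Matrix n E R) (x : E → R) :
    (B * diagonal x * Bᵀ).det = ∑ T ∈ Finset.univ.powersetCard (Fintype.card n),
      (B * diagonal (fun e => if e ∈ T then (1 : R) else 0) * Bᵀ).det * ∏ e ∈ T, x e := by
  obtain ⟨c, hc⟩ := exists_det_mul_diagonal_mul_transpose_eq_sum B
  rw [hc x]
  refine Finset.sum_congr rfl fun T hT => ?_
  -- Evaluating at the indicator of `T` isolates its coefficient: all monomials have the same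
  -- degree, so no other one is supported inside `T`.
  rw [hc, Finset.sum_eq_single_of_mem T hT, Finset.prod_congr rfl fun e he => if_pos he,
    Finset.prod_const_one, mul_one]
  intro S hS hne
  have : ¬ S ⊆ T := fun h => hne (Finset.eq_of_subset_of_card_le h (by
    rw [Finset.mem_powersetCard_univ] at hS hT
    rw [hS, hT]))
  obtain ⟨e, heS, heT⟩ := Finset.not_subset.1 this
  rw [Finset.prod_eq_zero heS (if_neg heT), mul_zero]

/-- Changing one weight is a rank-one update, so the matrix determinant lemma applies. -/
theorem det_mul_diagonal_add_single_mul_transpose (B : Matrix n E R) (x : E → R)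
    (h : IsUnit (B * diagonal x * Bᵀ).det) (e : E) (t : R) :
    (B * diagonal (x + t • Pi.single e 1) * Bᵀ).det =
      (B * diagonal x * Bᵀ).det * (1 + t * (Bᵀ * (B * diagonal x * Bᵀ)⁻¹ * B) e e) := by
  have : B * diagonal (x + t • Pi.single e 1) * Bᵀ = B * diagonal x * Bᵀ +
      replicateCol Unit (fun i => t * B i e) * replicateRow Unit (fun i => B i e) := by
    ext i j
    rw [add_apply, mul_diagonal_mul_transpose_apply, mul_diagonal_mul_transpose_apply]
    simp [mul_apply, mul_add, add_mul, Finset.sum_add_distrib, Pi.single_apply]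
    ring
  rw [this, det_add_replicateCol_mul_replicateRow h, det_unique (n := Unit), add_apply,
    one_apply_eq, mul_apply, mul_apply (N := B), Finset.mul_sum]
  congr 2
  refine Finset.sum_congr rfl fun i _ => ?_
  simp only [mul_apply, replicateRow_apply, replicateCol_apply, transpose_apply]
  ring

theorem PosSemidef.det_le_exp_trace_sub_card {M : Matrix n n ℝ} (hM : M.PosSemidef) :
    M.det ≤ Real.exp (M.trace - Fintype.card n) := by
  rw [hM.isHermitian.det_eq_prod_eigenvalues, hM.isHermitian.trace_eq_sum_eigenvalues]
  calc ∏ i, hM.isHermitian.eigenvalues i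
      ≤ ∏ i, Real.exp (hM.isHermitian.eigenvalues i - 1) :=
        Finset.prod_le_prod (fun i _ => hM.eigenvalues_nonneg i) fun i _ => by
          simpa using Real.add_one_le_exp (hM.isHermitian.eigenvalues i - 1)
    _ = _ := by
        rw [← Real.exp_sum, Finset.sum_sub_distrib]
        simp

-- Factor A⁻¹ = SᴴS and apply the previous bound to the positive semidefinite matrix S C Sᴴ.
open scoped MatrixOrder in
theorem PosDef.det_le_det_mul_exp {A C : Matrix n n ℝ} (hA : A.PosDef) (hC : C.PosSemidef) :
    C.det ≤ A.det * Real.exp ((A⁻¹ * C).trace - Fintype.card n) := by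
  obtain ⟨S, hS⟩ := CStarAlgebra.nonneg_iff_eq_star_mul_self.mp hA.inv.posSemidef.nonneg
  rw [star_eq_conjTranspose] at hS
  have h := (hC.mul_mul_conjTranspose_same S).det_le_exp_trace_sub_card
  have htr : (S * C * Sᴴ).trace = (A⁻¹ * C).trace := by
    rw [trace_mul_comm, ← Matrix.mul_assoc, hS]
  have hdet : (S * C * Sᴴ).det = A.det⁻¹ * C.det := by
    rw [det_mul, det_mul, ← Ring.inverse_eq_inv', ← det_nonsing_inv, hS, det_mul]
    ring
  rw [htr, hdet, inv_mul_le_iff₀ hA.det_pos] at h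
  exact h

end Matrix

/-! ### The matrix-tree theorem. -/

namespace WeightedTrees

variable {V : Type*} (G : SimpleGraph V)

/-- The oriented incidence matrix of `G` with the row of the vertex `r` deleted. -/
noncomputable def reducedIncidence [DecidableEq V] (R : Type*) [CommRing R] (r : V) :
    Matrix {v // v ≠ r} G.edgeSet R :=
  fun v e => (if v.1 = (Quot.out e.1).1 then 1 else 0) - (if v.1 = (Quot.out e.1).2 then 1 else 0)

variable {G}

theorem mk_out (e : Sym2 V) : s((Quot.out e).1, (Quot.out e).2) = e :=
  Quot.out_eq e

theorem fromEdgeSet_adj_iff {T : Finset G.edgeSet} {u v : V} :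
    (SimpleGraph.fromEdgeSet (Subtype.val '' (T : Set G.edgeSet))).Adj u v ↔
      ∃ e ∈ T, e.1 = s(u, v) := by
  rw [SimpleGraph.fromEdgeSet_adj]
  constructor
  · rintro ⟨⟨e, he, h⟩, -⟩
    exact ⟨e, he, h⟩
  · rintro ⟨e, he, h⟩
    refine ⟨⟨e, he, h⟩, ?_⟩
    have := e.2
    rw [h, SimpleGraph.mem_edgeSet] at this
    exact this.ne

theorem card_edgeSet_fromEdgeSet (T : Finset G.edgeSet) :
    Nat.card (SimpleGraph.fromEdgeSet (Subtype.val '' (T : Set G.edgeSet))).edgeSet = T.card := by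
  have : (SimpleGraph.fromEdgeSet (Subtype.val '' (T : Set G.edgeSet))).edgeSet =
      Subtype.val '' (T : Set G.edgeSet) := by
    ext e
    induction e with
    | _ u v =>
      rw [SimpleGraph.mem_edgeSet, fromEdgeSet_adj_iff]
      rfl
  rw [this, Nat.card_image_of_injective Subtype.val_injective]
  simp

variable [Fintype V] [DecidableEq V] {r : V} {T : Finset G.edgeSet}

/-- Summing signed columns along a walk from `v` to `r` telescopes to the basis vector at `v`, the
row of `r` being deleted; this yields a right inverse. Working over ℤ forces the determinant to be
±1. -/
theorem isUnit_reducedIncidence_submatrix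
    (hT : (SimpleGraph.fromEdgeSet (Subtype.val '' (T : Set G.edgeSet))).Connected)
    (σ : {v // v ≠ r} ≃ T) :
    IsUnit ((reducedIncidence G ℤ r).submatrix id fun i => (σ i : G.edgeSet)) := by
  set M := (reducedIncidence G ℤ r).submatrix id fun i => (σ i : G.edgeSet) with hM
  have key : ∀ u v, (SimpleGraph.fromEdgeSet (Subtype.val '' (T : Set G.edgeSet))).Reachable u v →
      ∃ y, ∀ w : {v // v ≠ r}, M.mulVec y w =
        (if w.1 = u then 1 else 0) - (if w.1 = v then 1 else 0) := by
    rintro u v ⟨p⟩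
    induction p with
    | nil => exact ⟨0, by simp⟩
    | @cons a b c h p ih =>
      obtain ⟨y, hy⟩ := ih
      obtain ⟨e, he, hab⟩ := fromEdgeSet_adj_iff.1 h
      have col : ∀ w s, M.mulVec (Pi.single (σ.symm ⟨e, he⟩) s) w =
          ((if w.1 = (Quot.out e.1).1 then 1 else 0) -
            (if w.1 = (Quot.out e.1).2 then 1 else 0)) * s := by
        intro w s
        simp [hM, Matrix.mulVec_single, reducedIncidence]
      have := mk_out e.1
      rw [hab, Sym2.eq_iff, ← hab] at this
      -- The walk may traverse the edge with or against the orientation chosen by `Quot.out`.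
      rcases this with ⟨h1, h2⟩ | ⟨h1, h2⟩
      · refine ⟨Pi.single (σ.symm ⟨e, he⟩) 1 + y, fun w => ?_⟩
        rw [Matrix.mulVec_add, Pi.add_apply, hy, col, h1, h2]
        ring
      · refine ⟨Pi.single (σ.symm ⟨e, he⟩) (-1) + y, fun w => ?_⟩
        rw [Matrix.mulVec_add, Pi.add_apply, hy, col, h1, h2]
        ring
  choose y hy using fun v : {v // v ≠ r} => key v r (hT.preconnected v r)
  have inv : M * Matrix.of (fun i j => y j i) = 1 := by
    ext w v
    have := hy v w
    rw [if_neg w.2, sub_zero] at this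
    simp only [Matrix.one_apply, Subtype.ext_iff]
    exact this
  exact (Matrix.isUnit_iff_isUnit_det _).2 (Matrix.isUnit_det_of_right_inverse inv)

/-- The indicator of the vertices not reachable from `r` is a nonzero left kernel vector, being
constant along each edge of `T`. -/
theorem det_reducedIncidence_submatrix_eq_zero
    (hT : ¬ (SimpleGraph.fromEdgeSet (Subtype.val '' (T : Set G.edgeSet))).Connected)
    (σ : {v // v ≠ r} ≃ T) :
    ((reducedIncidence G ℝ r).submatrix id fun i => (σ i : G.edgeSet)).det = 0 := by
  classical
  set H := SimpleGraph.fromEdgeSet (Subtype.val '' (T : Set G.edgeSet)) with hH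
  have hu : ∃ u, ¬ H.Reachable r u := by
    by_contra! hcon
    exact hT ((SimpleGraph.connected_iff _).2 ⟨fun a b => (hcon a).symm.trans (hcon b), ⟨r⟩⟩)
  obtain ⟨u, hu⟩ := hu
  have hur : u ≠ r := fun h => hu (h ▸ SimpleGraph.Reachable.refl _)
  let z : V → ℝ := fun v => if H.Reachable r v then 0 else 1
  have hzr : z r = 0 := if_pos (SimpleGraph.Reachable.refl _)
  refine Matrix.exists_vecMul_eq_zero_iff.1 ⟨fun v => z v, fun h => ?_, ?_⟩
  · have := congrFun h ⟨u, hur⟩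
    simp [z, hu] at this
  · ext i
    have sum_eq : ∀ a, ∑ v : {v // v ≠ r}, z v * (if v.1 = a then 1 else 0) = z a := by
      intro a
      have h1 := Fintype.sum_subtype_add_sum_subtype (fun v => v ≠ r)
        (fun v => z v * (if v = a then 1 else 0))
      have h2 : ∑ v : {v // ¬ v ≠ r}, z v * (if v.1 = a then 1 else 0) = 0 :=
        Finset.sum_eq_zero fun v _ => by rw [not_not.1 v.2, hzr, zero_mul]
      rw [h2, add_zero] at h1
      rw [h1]
      simp
    simp only [Matrix.vecMul, dotProduct, Matrix.submatrix_apply, id, reducedIncidence, mul_sub,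
      Finset.sum_sub_distrib, Pi.zero_apply, sum_eq]
    have adj : H.Adj (Quot.out (σ i).1.1).1 (Quot.out (σ i).1.1).2 :=
      fromEdgeSet_adj_iff.2 ⟨_, (σ i).2, (mk_out _).symm⟩
    have : H.Reachable r (Quot.out (σ i).1.1).1 ↔ H.Reachable r (Quot.out (σ i).1.1).2 :=
      ⟨fun h => h.trans adj.reachable, fun h => h.trans adj.symm.reachable⟩
    simp [z, this]

open Classical in
theorem det_reducedIncidence_submatrix_sq (σ : {v // v ≠ r} ≃ T) :
    ((reducedIncidence G ℝ r).submatrix id fun i => (σ i : G.edgeSet)).det ^ 2 =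
      if (SimpleGraph.fromEdgeSet (Subtype.val '' (T : Set G.edgeSet))).IsTree then 1 else 0 := by
  have card : T.card + 1 = Nat.card V := by
    have := Fintype.card_congr σ
    rw [Fintype.card_coe, Fintype.card_subtype_compl, Fintype.card_subtype_eq] at this
    have : 0 < Fintype.card V := Fintype.card_pos_iff.2 ⟨r⟩
    rw [Nat.card_eq_fintype_card]
    omega
  rw [SimpleGraph.isTree_iff_connected_and_card, card_edgeSet_fromEdgeSet, and_iff_left card]
  split_ifs with h
  · have hmap : (reducedIncidence G ℝ r).submatrix id (fun i => (σ i : G.edgeSet)) =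
        ((reducedIncidence G ℤ r).submatrix id fun i => (σ i : G.edgeSet)).map
          (Int.castRingHom ℝ) := by
      ext i j
      simp [reducedIncidence]
    rw [hmap, ← RingHom.mapMatrix_apply, ← RingHom.map_det, ← map_pow, Int.isUnit_sq
      ((Matrix.isUnit_iff_isUnit_det _).1 (isUnit_reducedIncidence_submatrix h σ)), map_one]
  · rw [det_reducedIncidence_submatrix_eq_zero h σ, zero_pow two_ne_zero]

variable [DecidableRel G.Adj]

/-- The weighted **matrix-tree theorem**. -/
theorem treeNumber_eq_det (r : V) (x : G.edgeSet → ℝ) :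
    treeNumber G x =
      (reducedIncidence G ℝ r * Matrix.diagonal x * (reducedIncidence G ℝ r).transpose).det := by
  classical
  rw [Matrix.det_mul_diagonal_mul_transpose]
  have hcoef : ∀ S ∈ Finset.univ.powersetCard (Fintype.card {v // v ≠ r}),
      (reducedIncidence G ℝ r * Matrix.diagonal (fun e => if e ∈ S then (1 : ℝ) else 0) *
        (reducedIncidence G ℝ r).transpose).det * ∏ e ∈ S, x e =
      if S ∈ spanningTrees G then ∏ e ∈ S, x e else 0 := by
    intro S hS
    rw [Finset.mem_powersetCard_univ, ← Fintype.card_coe] at hS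
    rw [Matrix.det_mul_diagonal_indicator_mul_transpose _ (Fintype.equivOfCardEq hS.symm),
      det_reducedIncidence_submatrix_sq]
    simp [spanningTrees]
  rw [Finset.sum_congr rfl hcoef, ← Finset.sum_filter, treeNumber]
  refine Finset.sum_congr ?_ fun _ _ => rfl
  ext S
  rw [Finset.mem_filter, Finset.mem_powersetCard_univ, iff_and_self]
  intro hS
  have hS := (SimpleGraph.isTree_iff_connected_and_card.1 (Finset.mem_filter.1 hS).2).2
  rw [card_edgeSet_fromEdgeSet, Nat.card_eq_fintype_card] at hS
  rw [Fintype.card_subtype_compl, Fintype.card_subtype_eq]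
  omega

end WeightedTrees

/-! ### Effective resistances and maximality. -/

namespace WeightedTrees

variable {V : Type*} [Fintype V] {G : SimpleGraph V} [DecidableRel G.Adj]

theorem spanningTrees_nonempty (hG : G.Connected) : (spanningTrees G).Nonempty := by
  classical
  obtain ⟨H, hle, hH⟩ := hG.exists_isTree_le
  refine ⟨Finset.univ.filter fun e => e.1 ∈ H.edgeSet, Finset.mem_filter.2 ⟨Finset.mem_univ _, ?_⟩⟩
  convert hH
  ext u v
  rw [fromEdgeSet_adj_iff]
  constructor
  · rintro ⟨e, he, h⟩
    simpa [h] using he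
  · intro h
    exact ⟨⟨s(u, v), hle h⟩, by simpa using h, rfl⟩

theorem treeNumber_pos (hG : G.Connected) {x : G.edgeSet → ℝ} (hx : ∀ e, 0 < x e) :
    0 < treeNumber G x :=
  Finset.sum_pos (fun _ _ => Finset.prod_pos fun e _ => hx e) (spanningTrees_nonempty hG)

theorem differentiable_treeNumber : Differentiable ℝ (treeNumber G) := by
  unfold treeNumber
  fun_prop

theorem positiveWeightings_subset_weightings : positiveWeightings G ⊆ weightings G :=
  fun _ hf => ⟨fun e => (hf.1 e).le, hf.2⟩

variable [DecidableEq V]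

theorem hasLineDerivAt_treeNumber_single (r : V) {x : G.edgeSet → ℝ} (hx : treeNumber G x ≠ 0)
    (e : G.edgeSet) :
    HasLineDerivAt ℝ (treeNumber G)
      (treeNumber G x * ((reducedIncidence G ℝ r).transpose *
        (reducedIncidence G ℝ r * Matrix.diagonal x * (reducedIncidence G ℝ r).transpose)⁻¹ *
        reducedIncidence G ℝ r) e e) x (Pi.single e 1) := by
  have hdet := treeNumber_eq_det r x
  have : IsUnit (reducedIncidence G ℝ r * Matrix.diagonal x *
      (reducedIncidence G ℝ r).transpose).det := by
    rw [← hdet]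
    exact hx.isUnit
  have hline := fun t : ℝ => Matrix.det_mul_diagonal_add_single_mul_transpose _ x this e t
  simp only [← treeNumber_eq_det] at hline
  unfold HasLineDerivAt
  simp only [hline]
  simpa using (((hasDerivAt_id (0 : ℝ)).mul_const _).const_add 1).const_mul (treeNumber G x)

theorem effectiveResistance_eq (r : V) {x : G.edgeSet → ℝ} (hx : treeNumber G x ≠ 0)
    (e : G.edgeSet) :
    effectiveResistance G x e = ((reducedIncidence G ℝ r).transpose *
        (reducedIncidence G ℝ r * Matrix.diagonal x * (reducedIncidence G ℝ r).transpose)⁻¹ *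
        reducedIncidence G ℝ r) e e := by
  rw [effectiveResistance, treeNumberPartial,
    (hasLineDerivAt_treeNumber_single r hx e).lineDeriv, mul_div_cancel_left₀ _ hx]

theorem treeNumber_le_mul_exp [Nonempty V] {f g : G.edgeSet → ℝ} (hf : ∀ e, 0 ≤ f e)
    (hg : ∀ e, 0 ≤ g e) (hτ : treeNumber G f ≠ 0) :
    treeNumber G g ≤ treeNumber G f * Real.exp
      (∑ e, g e * effectiveResistance G f e - ∑ e, f e * effectiveResistance G f e) := by
  obtain ⟨r⟩ := ‹Nonempty V›
  have hpos := (Matrix.posSemidef_mul_diagonal_mul_transpose (reducedIncidence G ℝ r) hf)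
  have hdet := hτ
  rw [treeNumber_eq_det r] at hdet
  have h := (hpos.posDef_iff_det_ne_zero.2 hdet).det_le_det_mul_exp
    (Matrix.posSemidef_mul_diagonal_mul_transpose (reducedIncidence G ℝ r) hg)
  -- Foster's identity: the trace of L⁻¹L = 1 gives Σ f_e R_e = |V| - 1.
  have hcard := congrArg Matrix.trace (Matrix.nonsing_inv_mul _ hdet.isUnit)
  rw [Matrix.trace_mul_mul_diagonal_mul_transpose, Matrix.trace_one] at hcard
  rw [Matrix.trace_mul_mul_diagonal_mul_transpose, ← hcard] at h
  simp only [← effectiveResistance_eq r hτ, ← treeNumber_eq_det] at h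
  exact h

theorem isMaxOn_weightings_of_effectiveResistance_eq [Nonempty V] {f : G.edgeSet → ℝ}
    (hf : f ∈ weightings G) (hτ : treeNumber G f ≠ 0)
    (h : ∀ e e', effectiveResistance G f e = effectiveResistance G f e') :
    IsMaxOn (treeNumber G) (weightings G) f := by
  intro g hg
  have hsum : ∑ e, g e * effectiveResistance G f e = ∑ e, f e * effectiveResistance G f e := by
    rcases isEmpty_or_nonempty G.edgeSet with _ | ⟨⟨e⟩⟩
    · simp
    · simp only [h _ e, ← Finset.sum_mul, hf.2, hg.2]
  simpa [hsum] using treeNumber_le_mul_exp hf.1 hg.1 hτ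

theorem treeNumberPartial_eq_of_isMaxOn {f : G.edgeSet → ℝ} (hf : f ∈ positiveWeightings G)
    (h : IsMaxOn (treeNumber G) (positiveWeightings G) f) (e e' : G.edgeSet) :
    treeNumberPartial G f e = treeNumberPartial G f e' := by
  have hd := differentiable_treeNumber (G := G) f
  -- This direction preserves the total weight, and positivity of `f` keeps small steps of either
  -- sign inside the interior.
  have hline : HasDerivAt (fun t : ℝ => treeNumber G (f + t • (Pi.single e 1 - Pi.single e' 1)))
      (fderiv ℝ (treeNumber G) f (Pi.single e 1 - Pi.single e' 1)) 0 :=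
    hd.hasFDerivAt.hasLineDerivAt _
  have hmax : IsLocalMax
      (fun t : ℝ => treeNumber G (f + t • (Pi.single e 1 - Pi.single e' 1))) 0 := by
    have hpos : ∀ᶠ t in nhds (0 : ℝ), ∀ a,
        0 < (f + t • (Pi.single e 1 - Pi.single e' 1) : G.edgeSet → ℝ) a := by
      refine Filter.eventually_all.2 fun a => ?_
      have hc : Continuous fun t : ℝ =>
          (f + t • (Pi.single e 1 - Pi.single e' 1) : G.edgeSet → ℝ) a := by
        simp only [Pi.add_apply, Pi.smul_apply]
        fun_prop
      exact hc.continuousAt.eventually (lt_mem_nhds (by simpa using hf.1 a))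
    filter_upwards [hpos] with t ht
    simpa using h ⟨ht, by
      simp [Finset.sum_add_distrib, ← Finset.mul_sum, hf.2]⟩
  have hzero := hmax.hasDerivAt_eq_zero hline
  rw [map_sub, sub_eq_zero] at hzero
  rw [treeNumberPartial, treeNumberPartial, hd.lineDeriv_eq_fderiv, hd.lineDeriv_eq_fderiv, hzero]

theorem treeNumberPartial_one (e : G.edgeSet) :
    treeNumberPartial G (fun _ => 1) e = ((spanningTrees G).filter fun T => e ∈ T).card := by
  have hline : ∀ t : ℝ, treeNumber G ((fun _ => 1) + t • Pi.single e 1) =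
      ∑ T ∈ spanningTrees G, (1 + if e ∈ T then t else 0) := by
    intro t
    refine Finset.sum_congr rfl fun T _ => ?_
    split_ifs with he
    · rw [Finset.prod_eq_single_of_mem e he]
      · simp
      · intro a _ ha
        simp [ha]
    · rw [add_zero]
      refine Finset.prod_eq_one fun a ha => ?_
      have : a ≠ e := fun h => he (h ▸ ha)
      simp [this]
  have hderiv : HasLineDerivAt ℝ (treeNumber G)
      (((spanningTrees G).filter fun T => e ∈ T).card : ℝ) (fun _ => 1) (Pi.single e 1) := by
    unfold HasLineDerivAt
    simp only [hline, Finset.sum_add_distrib, ← Finset.sum_filter, Finset.sum_const, nsmul_eq_mul]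
    simpa using ((hasDerivAt_id (0 : ℝ)).const_mul
      (((spanningTrees G).filter fun T => e ∈ T).card : ℝ)).const_add ((spanningTrees G).card * 1 : ℝ)
  exact hderiv.lineDeriv

end WeightedTrees

open WeightedTrees in
theorem proposition1 {V : Type*} [Fintype V] [DecidableEq V] (G : SimpleGraph V)
    [DecidableRel G.Adj] (hG : G.Connected) :
    -- a weighting without vanishing weights is maximal, on the closed simplex as well as on
    -- its interior, if and only if all the effective resistances agree
    (∀ f ∈ positiveWeightings G,
      (IsMaxOn (treeNumber G) (weightings G) f ↔
        ∀ e e' : G.edgeSet, effectiveResistance G f e = effectiveResistance G f e') ∧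
      (IsMaxOn (treeNumber G) (positiveWeightings G) f ↔
        ∀ e e' : G.edgeSet, effectiveResistance G f e = effectiveResistance G f e')) ∧
    -- equal effective resistances suffice on the boundary too, where they are defined
    (∀ f ∈ weightings G, treeNumber G f ≠ 0 →
      (∀ e e' : G.edgeSet, effectiveResistance G f e = effectiveResistance G f e') →
        IsMaxOn (treeNumber G) (weightings G) f) ∧
    -- the unweighted case
    ((∀ e e' : G.edgeSet,
        effectiveResistance G (fun _ => 1) e = effectiveResistance G (fun _ => 1) e') ↔
      Equiarboreal G) ∧
    (IsMaxOn (treeNumber G) (weightings G) (fun _ => 1) ↔ Equiarboreal G) := by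
  have : Nonempty V := hG.nonempty
  have interior : ∀ f ∈ positiveWeightings G,
      (IsMaxOn (treeNumber G) (weightings G) f ↔
        ∀ e e' : G.edgeSet, effectiveResistance G f e = effectiveResistance G f e') ∧
      (IsMaxOn (treeNumber G) (positiveWeightings G) f ↔
        ∀ e e' : G.edgeSet, effectiveResistance G f e = effectiveResistance G f e') := by
    intro f hf
    have restrict : IsMaxOn (treeNumber G) (weightings G) f →
        IsMaxOn (treeNumber G) (positiveWeightings G) f :=
      fun h => h.on_subset positiveWeightings_subset_weightings
    have equal : IsMaxOn (treeNumber G) (positiveWeightings G) f →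
        ∀ e e' : G.edgeSet, effectiveResistance G f e = effectiveResistance G f e' :=
      fun h e e' => congrArg (· / treeNumber G f) (treeNumberPartial_eq_of_isMaxOn hf h e e')
    have maximal := isMaxOn_weightings_of_effectiveResistance_eq
      (positiveWeightings_subset_weightings hf) (treeNumber_pos hG hf.1).ne'
    exact ⟨⟨fun h => equal (restrict h), maximal⟩, ⟨equal, fun h => restrict (maximal h)⟩⟩
  have unweighted : (∀ e e' : G.edgeSet,
      effectiveResistance G (fun _ => 1) e = effectiveResistance G (fun _ => 1) e') ↔
      Equiarboreal G := by
    have hne := (treeNumber_pos hG (x := fun _ => 1) fun _ => one_pos).ne'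
    simp only [effectiveResistance, div_left_inj' hne, treeNumberPartial_one, Nat.cast_inj,
      Equiarboreal]
  exact ⟨interior, fun f hf hτ h => isMaxOn_weightings_of_effectiveResistance_eq hf hτ h,
    unweighted, (interior _ ⟨fun _ => one_pos, by simp⟩).1.trans unweighted⟩
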